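/- Let $F$ be a finite field, let $r$ be a positive integer, and let $\alpha \in F$ be a nonzero element of multiplicative order at least $r$. Let $\ell \ge 0$ be an integer, let $\beta_0, \beta_1, \ldots, \beta_\ell$ be nonzero elements of $F$, and let $\mu_0, \mu_1, \ldots, \mu_\ell$ be positive integers with $\sum_{i=0}^{\ell} \mu_i = r$. For $0 \le i \le \ell$ put $\tau_i = r - \mu_i$ and \[ M_i(x;\beta_i) = \prod_{j=0}^{\tau_i - 1} \bigl(x - \beta_i \alpha^j\bigr) \in F[x]. \] Then the following two conditions are equivalent: (i) There exist polynomials $u_i(x) \in F[x]$, $0 \le i \le \ell$, not all zero, each $u_i$ being zero or of degree less than $\mu_i$, such that \[ \sum_{i=0}^{\ell} u_i(x)\, M_i(x;\beta_i) = 0 . \] (ii) There are distinct $i, k \in \{0, 1, \ldots, \ell\}$ and an integer $t$ with $-\mu_i < t < \mu_k$ such that \[ \frac{\beta_k}{\beta_i} = \alpha^t . \] -/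

import Mathlib

/-- The polynomial `M(x; β) = ∏_{j=0}^{τ-1} (x - β α ^ j)` over `F`, of degree `τ`. -/
noncomputable def geomProgPoly {F : Type*} [Field F] (α β : F) (τ : ℕ) : Polynomial F :=
  ∏ j ∈ Finset.range τ, (Polynomial.X - Polynomial.C (β * α ^ j))

/-! For `s < μ i` put γ = β_i / α^s. The polynomial M(x; γ) of degree r - 1 is M_i times a cofactor
of degree μ_i - 1. There are r such pairs (i, s). If two pairs with different i share γ, equating
the two factorizations gives a relation (i). If all γ are distinct, the r polynomials M(x; γ) are
independent by Vandermonde, so the map (u_i) ↦ ∑ u_i M_i, on a space of dimension r, has rank at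
least r and is injective. Condition (ii) says exactly that γ coincides for two different i. -/

open Polynomial in
theorem geomProgPoly_monic {F : Type*} [Field F] (α β : F) (n : ℕ) :
    (geomProgPoly α β n).Monic :=
  monic_prod_of_monic _ _ fun j _ => monic_X_sub_C (β * α ^ j)

open Polynomial in
theorem geomProgPoly_natDegree {F : Type*} [Field F] (α β : F) (n : ℕ) :
    (geomProgPoly α β n).natDegree = n := by
  rw [geomProgPoly, natDegree_prod_of_monic _ _ fun j _ => monic_X_sub_C (β * α ^ j)]
  simp only [natDegree_X_sub_C, Finset.sum_const, Finset.card_range, smul_eq_mul, mul_one]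

theorem geomProgPoly_add {F : Type*} [Field F] (α β : F) (a b : ℕ) :
    geomProgPoly α β (a + b) = geomProgPoly α β a * geomProgPoly α (β * α ^ a) b := by
  simp [geomProgPoly, Finset.prod_range_add, pow_add, mul_assoc]

open Polynomial in
/-- The polynomial `M(x; γ)` of degree `r - 1` is a multiple of `M(x; β)` of degree `r - m` when
`β = γ α ^ s` with `s < m`. -/
theorem exists_geomProgPoly_eq_mul {F : Type*} [Field F] {α β γ : F} {r m s : ℕ} (hmr : m ≤ r)
    (hs : s < m) (hγ : γ * α ^ s = β) :
    ∃ u ∈ degreeLT F m, u ≠ 0 ∧ geomProgPoly α γ (r - 1) = u * geomProgPoly α β (r - m) := by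
  -- The cofactor collects the s roots before β and the m - 1 - s roots after the block of r - m.
  refine ⟨geomProgPoly α γ s * geomProgPoly α (β * α ^ (r - m)) (m - 1 - s), ?_, ?_, ?_⟩
  · have hm := (geomProgPoly_monic α γ s).mul
      (geomProgPoly_monic α (β * α ^ (r - m)) (m - 1 - s))
    rw [mem_degreeLT, degree_eq_natDegree hm.ne_zero,
      (geomProgPoly_monic α γ s).natDegree_mul (geomProgPoly_monic _ _ _),
      geomProgPoly_natDegree, geomProgPoly_natDegree]
    exact_mod_cast (by omega : s + (m - 1 - s) < m)
  · exact mul_ne_zero (geomProgPoly_monic _ _ _).ne_zero (geomProgPoly_monic _ _ _).ne_zero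
  · rw [show r - 1 = s + ((r - m) + (m - 1 - s)) by omega, geomProgPoly_add, geomProgPoly_add, hγ]
    ring

open Polynomial in
theorem geomProgPoly_coeff {F : Type*} [Field F] (α β : F) (n m : ℕ) (hm : m ≤ n) :
    (geomProgPoly α β n).coeff m = β ^ (n - m) * (geomProgPoly α 1 n).coeff m := by
  induction n generalizing m with
  | zero => obtain rfl : m = 0 := by omega
            simp [geomProgPoly]
  | succ n ih =>
    have h (γ : F) : geomProgPoly α γ (n + 1) =
        geomProgPoly α γ n * (X - C (γ * α ^ n)) := by
      simp [geomProgPoly, Finset.prod_range_succ]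
    have htop (γ : F) : (geomProgPoly α γ n).coeff (n + 1) = 0 :=
      coeff_eq_zero_of_natDegree_lt (by rw [geomProgPoly_natDegree]; omega)
    rw [h, h]
    rcases m with _ | m
    · have := ih 0 (by omega)
      simp only [mul_sub, coeff_sub, coeff_mul_X_zero, coeff_mul_C, this]
      simp only [Nat.sub_zero, pow_succ]
      ring
    · simp only [mul_sub, coeff_sub, coeff_mul_X, coeff_mul_C, ih m (by omega)]
      rcases Nat.lt_or_ge m n with hlt | hge
      · rw [ih (m + 1) (by omega), show n + 1 - (m + 1) = n - (m + 1) + 1 by omega,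
          show n - m = n - (m + 1) + 1 by omega, pow_succ]
        ring
      · obtain rfl : m = n := by omega
        simp [htop]

-- Substituting αx shifts the roots 1, …, α^(n-1) by one step, so only the two end factors change.
open Polynomial in
theorem geomProgPoly_comp_mul_eq {F : Type*} [Field F] (α : F) (n : ℕ) :
    (geomProgPoly α 1 n).comp (C α * X) * (C α * X - C (α ^ n)) =
      C (α ^ n) * ((C α * X - 1) * geomProgPoly α 1 n) := by
  induction n with
  | zero => simp [geomProgPoly]
  | succ n ih =>
    have h : geomProgPoly α 1 (n + 1) = geomProgPoly α 1 n * (X - C (α ^ n)) := by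
      simp [geomProgPoly, Finset.prod_range_succ]
    have h2 : (C α * X - C (α ^ (n + 1)) : F[X]) = C α * (X - C (α ^ n)) := by
      simp only [pow_succ, C_mul]; ring
    rw [h, mul_comp, h2]
    have h3 : (X - C (α ^ n) : F[X]).comp (C α * X) = C α * X - C (α ^ n) := by
      simp
    rw [h3, pow_succ, C_mul]
    linear_combination (C α * (X - C (α ^ n))) * ih

-- The functional equation gives a two-term recurrence: if the coefficient at m vanishes, so does
-- α^n (α^(m+1) - 1) times the one at m + 1. Descend from the leading coefficient.
open Polynomial in
theorem geomProgPoly_one_coeff_ne_zero {F : Type*} [Field F] {α : F} (hα : α ≠ 0) {n m : ℕ}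
    (hn : n < orderOf α) (hm : m ≤ n) : (geomProgPoly α 1 n).coeff m ≠ 0 := by
  induction hm using Nat.decreasingInduction with
  | self =>
    have := (geomProgPoly_monic α 1 n).coeff_natDegree
    rw [geomProgPoly_natDegree] at this
    simp [this]
  | of_succ m hmn ih =>
    intro h0
    have h := congrArg (fun p => coeff p (m + 1)) (geomProgPoly_comp_mul_eq α n)
    simp only [mul_sub, sub_mul, one_mul, coeff_sub, ← mul_assoc, coeff_mul_C, mul_right_comm _ X,
      coeff_mul_X, ← C_mul, coeff_C_mul, comp_C_mul_X_coeff, h0, zero_mul, mul_zero] at h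
    have h1 : α ^ n * (α ^ (m + 1) - 1) * (geomProgPoly α 1 n).coeff (m + 1) = 0 := by
      linear_combination -h
    have h2 : α ^ (m + 1) ≠ 1 := pow_ne_one_of_lt_orderOf (by omega) (by omega)
    exact mul_ne_zero (mul_ne_zero (pow_ne_zero _ hα) (sub_ne_zero.2 h2)) ih h1

open Polynomial in
theorem linearIndependent_geomProgPoly {F ι : Type*} [Field F] [Fintype ι] {α : F} (hα : α ≠ 0)
    {r : ℕ} (hr : 0 < r) (hord : r ≤ orderOf α) (hι : Fintype.card ι = r) {γ : ι → F}
    (hγ : Function.Injective γ) :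
    LinearIndependent F fun i => geomProgPoly α (γ i) (r - 1) := by
  let e : Fin r ≃ ι := (Fintype.equivFinOfCardEq hι).symm
  rw [← linearIndependent_equiv e, Fintype.linearIndependent_iff]
  intro a ha i
  -- The coefficient at r - 1 - k is γ^k times a nonzero constant independent of γ, so a relation
  -- yields a Vandermonde system.
  refine congrFun (Matrix.eq_zero_of_forall_pow_sum_mul_pow_eq_zero (f := γ ∘ e) (v := a)
    (hγ.comp e.injective) fun k => ?_) i
  have h := congrArg (fun p => coeff p (r - 1 - k)) ha
  have hk := k.isLt
  have hc (β : F) := geomProgPoly_coeff α β (r - 1) (r - 1 - k) (by omega)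
  rw [show r - 1 - (r - 1 - (k : ℕ)) = k by omega] at hc
  simp only [finsetSum_coeff, coeff_smul, Function.comp, smul_eq_mul, coeff_zero] at h
  rw [Finset.sum_congr rfl fun j _ => by rw [hc, ← mul_assoc], ← Finset.sum_mul] at h
  exact (mul_eq_zero.1 h).resolve_right
    (geomProgPoly_one_coeff_ne_zero hα (by omega) (by omega))

open Polynomial in
theorem injective_sum_mul_geomProgPoly {F : Type*} [Field F] {r : ℕ} (hr : 0 < r)
    {α : F} (hα : α ≠ 0) (hord : r ≤ orderOf α) {ι : Type*} [Fintype ι] (β : ι → F)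
    (μ : ι → ℕ) (hsum : ∑ i, μ i = r)
    (hγ : Function.Injective fun p : (i : ι) × Fin (μ i) => β p.1 / α ^ (p.2 : ℕ))
    (u : ι → F[X]) (hu : ∀ i, u i ∈ degreeLT F (μ i))
    (h0 : ∑ i, u i * geomProgPoly α (β i) (r - μ i) = 0) (i : ι) : u i = 0 := by
  classical
  have (n : ℕ) : Module.Finite F (degreeLT F n) := Module.Finite.equiv (degreeLTEquiv F n).symm
  let Φ : ((i : ι) → degreeLT F (μ i)) →ₗ[F] F[X] :=
    ∑ i, (LinearMap.mulRight F (geomProgPoly α (β i) (r - μ i))) ∘ₗ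
      (degreeLT F (μ i)).subtype ∘ₗ LinearMap.proj i
  have hΦ (w) : Φ w = ∑ i, (w i : F[X]) * geomProgPoly α (β i) (r - μ i) := by
    simp [Φ]
  have hdom : Module.finrank F ((i : ι) → degreeLT F (μ i)) = r := by
    rw [Module.finrank_pi_fintype, ← hsum]
    exact Finset.sum_congr rfl fun i _ => by
      rw [(degreeLTEquiv F (μ i)).finrank_eq, Module.finrank_fin_fun]
  have hli := linearIndependent_geomProgPoly hα hr hord (by simp [hsum]) hγ
  have hle : r ≤ Module.finrank F Φ.range := by
    have := finrank_span_eq_card hli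
    rw [Fintype.card_sigma] at this
    simp only [Fintype.card_fin, hsum] at this
    rw [← this]
    refine Submodule.finrank_mono (Submodule.span_le.2 ?_)
    rintro _ ⟨⟨j, s⟩, rfl⟩
    obtain ⟨v, hv, -, hvP⟩ := exists_geomProgPoly_eq_mul (α := α) (β := β j)
      (γ := β j / α ^ (s : ℕ)) (r := r) (m := μ j)
      (hsum ▸ Finset.single_le_sum (fun _ _ => Nat.zero_le _) (Finset.mem_univ j)) s.isLt
      (div_mul_cancel₀ _ (pow_ne_zero _ hα))
    refine ⟨Pi.single j ⟨v, hv⟩, ?_⟩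
    rw [hΦ, Finset.sum_eq_single j, Pi.single_eq_same]
    · exact hvP.symm
    · intro k _ hk
      simp [Pi.single_eq_of_ne hk]
    · simp
  have hker : Φ.ker = ⊥ := by
    have := Φ.finrank_range_add_finrank_ker
    exact Submodule.finrank_eq_zero.1 (by omega)
  have := LinearMap.ker_eq_bot'.1 hker (fun i => ⟨u i, hu i⟩) (by rw [hΦ]; exact h0)
  exact congrArg Subtype.val (congrFun this i)

theorem mainTheorem6 {F : Type*} [Field F] [Finite F] (r : ℕ) (hr : 0 < r)
    (α : F) (hα : α ≠ 0) (hord : r ≤ orderOf α)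
    (l : ℕ) (β : Fin (l + 1) → F) (hβ : ∀ i, β i ≠ 0)
    (μ : Fin (l + 1) → ℕ) (hμ : ∀ i, 0 < μ i) (hsum : ∑ i, μ i = r) :
    (∃ u : Fin (l + 1) → Polynomial F,
        (∀ i, u i ∈ Polynomial.degreeLT F (μ i)) ∧
        (∃ i, u i ≠ 0) ∧
        ∑ i, u i * geomProgPoly α (β i) (r - μ i) = 0) ↔
      ∃ i k : Fin (l + 1), i ≠ k ∧
        ∃ t : ℤ, -(μ i : ℤ) < t ∧ t < (μ k : ℤ) ∧ β k / β i = α ^ t := by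
  have hle (j) : μ j ≤ r :=
    hsum ▸ Finset.single_le_sum (fun _ _ => Nat.zero_le _) (Finset.mem_univ j)
  constructor
  · rintro ⟨u, hu, ⟨i, hi⟩, h0⟩
    by_contra hno
    refine hi (injective_sum_mul_geomProgPoly hr hα hord β μ hsum ?_ u hu h0 i)
    rintro ⟨i, s⟩ ⟨k, s'⟩ h
    simp only at h
    have hs := pow_ne_zero (s : ℕ) hα
    have hs' := pow_ne_zero (s' : ℕ) hα
    -- Within one i, both exponents are below r ≤ `orderOf α`, so they agree; across different i,
    -- equality would give (ii).
    by_cases hik : i = k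
    · subst hik
      have hpow : α ^ (s : ℕ) = α ^ (s' : ℕ) := by
        rw [div_eq_div_iff hs hs'] at h
        exact (mul_left_cancel₀ (hβ i) h).symm
      have := pow_injOn_Iio_orderOf (x := α) (Set.mem_Iio.2 ((s.isLt.trans_le (hle i)).trans_le hord))
        (Set.mem_Iio.2 ((s'.isLt.trans_le (hle i)).trans_le hord)) hpow
      rw [Fin.ext this]
    · refine (hno ⟨i, k, hik, (s' : ℤ) - (s : ℤ), by omega, by omega, ?_⟩).elim
      rw [zpow_sub₀ hα, zpow_natCast, zpow_natCast, div_eq_div_iff (hβ i) hs]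
      rw [div_eq_div_iff hs hs'] at h
      linear_combination -h
  · rintro ⟨i, k, hik, t, hti, htk, ht⟩
    -- Splitting t into positive and negative parts makes β_i / α^s = β_k / α^s' the common starting
    -- point.
    obtain ⟨s, s', hs, hs', rfl⟩ : ∃ s s' : ℕ, s < μ i ∧ s' < μ k ∧ t = (s' : ℤ) - s :=
      ⟨(-t).toNat, t.toNat, by have := hμ i; omega, by have := hμ k; omega, by omega⟩
    have hsα := pow_ne_zero s hα
    rw [zpow_sub₀ hα, zpow_natCast, zpow_natCast, div_eq_div_iff (hβ i) hsα] at ht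
    obtain ⟨a, ha, ha0, hPa⟩ := exists_geomProgPoly_eq_mul (α := α) (β := β i)
      (γ := β i / α ^ s) (hle i) hs (div_mul_cancel₀ _ hsα)
    obtain ⟨b, hb, -, hPb⟩ := exists_geomProgPoly_eq_mul (α := α) (β := β k)
      (γ := β i / α ^ s) (hle k) hs' (by field_simp; linear_combination -ht)
    refine ⟨Pi.single i a - Pi.single k b, fun j => Submodule.sub_mem _ ?_ ?_, ⟨i, ?_⟩, ?_⟩
    · by_cases hj : j = i
      · subst hj; simpa using ha
      · simp [Pi.single_eq_of_ne hj]
    · by_cases hj : j = k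
      · subst hj; simpa using hb
      · simp [Pi.single_eq_of_ne hj]
    · simpa [Pi.single_eq_of_ne hik] using ha0
    · simp [sub_mul, Finset.sum_sub_distrib, Pi.single_apply, ite_mul, ← hPa, ← hPb]
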